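/- A \emph{relation scheme with predicates} $(R,\Phi)$ is a finite set $R$ of attributes, each $B\in R$ with a domain $\mathrm{dom}(B)$ whose values are represented by bit strings and with a predicate $\phi_B:\mathrm{dom}(B)\times\mathrm{dom}(B)\to\{\mathtt{true},\mathtt{false}\}$; tuples $t$ assign to each $B\in R$ a value $t[B]\in\mathrm{dom}(B)$, and a relation is a finite set of tuples. For a functional dependency $X\to A$ ($X\cup\{A\}\subseteq R$), an ordered pair $(t_1,t_2)$ of tuples (possibly $t_1=t_2$) is a \emph{counterexample} if $\phi_B(t_1[B],t_2[B])=\mathtt{true}$ for all $B\in X$ but $\phi_A(t_1[A],t_2[A])=\mathtt{false}$; a relation $s$ satisfies $X\to A$, written $s\models_\Phi X\to A$, if no pair of tuples of $s$ is a counterexample. For a nonempty relation $r$ put \[ g_3^{\Phi}(r,X\to A)=1-\frac{\max\{|s| : s\subseteq r,\ s\models_\Phi X\to A\}}{|r|}. \] The Error Validation Problem with Predicates (EVPP) asks, given a nonempty relation $r$ over $(R,\Phi)$, a functional dependency $X\to A$ and a threshold $k$, whether $g_3^\Phi(r,X\to A)\le k$; the predicates are black-box oracles that can be computed in time polynomial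 in the size of their input. \textbf{Theorem.} Restricted to instances in which every predicate is symmetric and transitive: (1) EVPP, with rational $k$ written in binary, can be solved in polynomial time. That is, one oracle program decides all instances, and for every polynomial $q$ there is a polynomial $p$ such that, if each predicate evaluation takes time at most $q$ of the size of the query, the total running time, including the queries, is at most $p$ of the size of the input. (2) In the same sense, $\max\{|s| : s\subseteq r,\ s\models_\Phi X\to A\}$, and hence the exact value of $g_3^\Phi(r,X\to A)$, which settles $g_3^\Phi(r,X\to A)\le k$ for every real $k$, can be computed in polynomial time. (3) For every relation $r$ over such a scheme and every $X\to A$, let $r'$ be $r$ without the tuples $t$ for which $(t,t)$ is a counterexample. Then the conflict graph on $r'$, whose edges are the counterexamples, is a loopless undirected graph without induced path on four vertices, i.e. a cograph. -/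

import Mathlib

universe u

/-! ### Model of computation: the WHILE language over binary trees, with black-box queries -/

/-- Binary trees, the data that programs manipulate. -/
inductive Data where
  | nil : Data
  | cons : Data → Data → Data

namespace Data

/-- The number of nodes of a tree. -/
def size : Data → ℕ
  | nil => 1
  | cons a b => a.size + b.size + 1

def head : Data → Data
  | nil => nil
  | cons a _ => a

def tail : Data → Data
  | nil => nil
  | cons _ b => b

def ofBool : Bool → Data
  | false => nil
  | true => cons nil nil

def ofList : List Data → Data
  | [] => nil
  | a :: l => cons a (ofList l)

/-- Bit strings. -/
def ofBits (l : List Bool) : Data := ofList (l.map ofBool)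

/-- Unary numerals, used for attribute indices and for numbers of tuples. -/
def ofNat (n : ℕ) : Data := ofList (List.replicate n nil)

/-- Binary numerals. -/
def ofNatBinary (n : ℕ) : Data := ofBits (Computability.encodeNat n)

/-- Rational numbers: sign, absolute value of the numerator and denominator, both in binary. -/
def ofRat (k : ℚ) : Data :=
  cons (ofBool (decide (k < 0))) (cons (ofNatBinary k.num.natAbs) (ofNatBinary k.den))

end Data

/-- The content of the variables of a program. -/
abbrev Store := ℕ → Data

/-- Expressions of the WHILE language. -/
inductive Expr where
  | var : ℕ → Expr
  | nil : Expr
  | cons : Expr → Expr → Expr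
  | head : Expr → Expr
  | tail : Expr → Expr

namespace Expr

def eval (σ : Store) : Expr → Data
  | var i => σ i
  | nil => Data.nil
  | cons a b => Data.cons (a.eval σ) (b.eval σ)
  | head a => (a.eval σ).head
  | tail a => (a.eval σ).tail

/-- The time to evaluate an expression: every intermediate value is charged its full size
(there is no sharing), so that a computation of time `T` only produces data of size at most `T`. -/
def cost (σ : Store) : Expr → ℕ
  | var i => (σ i).size
  | nil => 1
  | cons a b => a.cost σ + b.cost σ + ((cons a b).eval σ).size
  | head a => a.cost σ + ((head a).eval σ).size
  | tail a => a.cost σ + ((tail a).eval σ).size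

end Expr

/-- Programs. `query i e` hands the value of `e` over to the black box and stores its Boolean
answer in variable `i`. -/
inductive Program where
  | skip : Program
  | assign : ℕ → Expr → Program
  | query : ℕ → Expr → Program
  | seq : Program → Program → Program
  | ite : Expr → Program → Program → Program
  | while : Expr → Program → Program

/-- A black box: its answers, and the time that it takes to produce each of them. -/
structure Oracle where
  answer : Data → Bool
  time : Data → ℕ

/-- `Exec O P σ τ n`: with black box `O`, the program `P` started in store `σ` halts in store `τ`
after time `n`. Tests regard `nil` as false and any other tree as true. The time of a query
is the time to build the query (at least its size) plus the time that the black box takes. -/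
inductive Exec (O : Oracle) : Program → Store → Store → ℕ → Prop where
  | skip (σ : Store) : Exec O .skip σ σ 1
  | assign (σ : Store) (i : ℕ) (e : Expr) :
      Exec O (.assign i e) σ (Function.update σ i (e.eval σ)) (1 + e.cost σ)
  | query (σ : Store) (i : ℕ) (e : Expr) :
      Exec O (.query i e) σ (Function.update σ i (Data.ofBool (O.answer (e.eval σ))))
        (1 + e.cost σ + O.time (e.eval σ))
  | seq {P Q : Program} {σ τ υ : Store} {m n : ℕ} (h₁ : Exec O P σ τ m) (h₂ : Exec O Q τ υ n) :
      Exec O (.seq P Q) σ υ (m + n)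
  | ite_true {e : Expr} {P Q : Program} {σ τ : Store} {n : ℕ} (he : e.eval σ ≠ Data.nil)
      (h : Exec O P σ τ n) : Exec O (.ite e P Q) σ τ (1 + e.cost σ + n)
  | ite_false {e : Expr} {P Q : Program} {σ τ : Store} {n : ℕ} (he : e.eval σ = Data.nil)
      (h : Exec O Q σ τ n) : Exec O (.ite e P Q) σ τ (1 + e.cost σ + n)
  | while_true {e : Expr} {P : Program} {σ τ υ : Store} {m n : ℕ} (he : e.eval σ ≠ Data.nil)
      (h₁ : Exec O P σ τ m) (h₂ : Exec O (.while e P) τ υ n) :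
      Exec O (.while e P) σ υ (1 + e.cost σ + m + n)
  | while_false {e : Expr} {P : Program} {σ : Store} (he : e.eval σ = Data.nil) :
      Exec O (.while e P) σ σ (1 + e.cost σ)

/-- Programs are deterministic: final store and running time are determined by the start. -/
theorem Exec.deterministic {O : Oracle} {P : Program} {σ τ τ' : Store} {n n' : ℕ}
    (h : Exec O P σ τ n) (h' : Exec O P σ τ' n') : τ = τ' ∧ n = n' := by
  induction h generalizing τ' n' with
  | skip => cases h'; exact ⟨rfl, rfl⟩
  | assign => cases h'; exact ⟨rfl, rfl⟩
  | query => cases h'; exact ⟨rfl, rfl⟩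
  | seq _ _ ih₁ ih₂ =>
    cases h' with
    | seq k₁ k₂ =>
      obtain ⟨rfl, rfl⟩ := ih₁ k₁
      obtain ⟨rfl, rfl⟩ := ih₂ k₂
      exact ⟨rfl, rfl⟩
  | ite_true he _ ih =>
    cases h' with
    | ite_true _ k => obtain ⟨rfl, rfl⟩ := ih k; exact ⟨rfl, rfl⟩
    | ite_false he' _ => exact absurd he' he
  | ite_false he _ ih =>
    cases h' with
    | ite_true he' _ => exact absurd he he'
    | ite_false _ k => obtain ⟨rfl, rfl⟩ := ih k; exact ⟨rfl, rfl⟩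
  | while_true he _ _ ih₁ ih₂ =>
    cases h' with
    | while_true _ k₁ k₂ =>
      obtain ⟨rfl, rfl⟩ := ih₁ k₁
      obtain ⟨rfl, rfl⟩ := ih₂ k₂
      exact ⟨rfl, rfl⟩
    | while_false he' => exact absurd he' he
  | while_false he =>
    cases h' with
    | while_true he' _ _ => exact absurd he he'
    | while_false _ => exact ⟨rfl, rfl⟩

/-- With black box `O` and input `d` (in variable `0`, all other variables being empty), `P` halts
with output `out` (in variable `0`) after time at most `T`. -/
def Outputs (O : Oracle) (P : Program) (d out : Data) (T : ℕ) : Prop :=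
  ∃ (τ : Store) (n : ℕ), Exec O P (Function.update (fun _ => Data.nil) 0 d) τ n ∧
    τ 0 = out ∧ n ≤ T

/-- The problem with instances `i : ι`, inputs `input i` and correct outputs `output i` is solved
in polynomial time. Here `boxes i q O` says that `O` is an admissible black box for the instance
`i` with running times bounded by `q`. One program must work for all instances and black boxes,
and the polynomial `p` depends only on the polynomial `q`. -/
def SolvableInPolyTime {ι : Type*} (input output : ι → Data)
    (boxes : ι → Polynomial ℕ → Oracle → Prop) : Prop :=
  ∃ P : Program, ∀ q : Polynomial ℕ, ∃ p : Polynomial ℕ, ∀ (i : ι) (O : Oracle), boxes i q O →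
    Outputs O P (input i) (output i) (p.eval (input i).size)

/-! ### Relation schemes with predicates -/

/-- A relation scheme with attributes `0, …, m - 1`, a domain for each attribute whose
values are represented by bit strings, and a predicate on each domain. -/
structure PredScheme where
  m : ℕ
  dom : Fin m → Type u
  code : (B : Fin m) → Computability.Encoding (dom B) Bool
  pred : (B : Fin m) → dom B → dom B → Bool

/-- The functional dependency `lhs → rhs`. -/
structure FuncDep (S : PredScheme.{u}) where
  lhs : Finset (Fin S.m)
  rhs : Fin S.m

namespace PredScheme

variable (S : PredScheme.{u})

/-- Every predicate is symmetric. -/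
def Symmetric : Prop := ∀ (B : Fin S.m) (x y : S.dom B), S.pred B x y = S.pred B y x

/-- Every predicate is transitive. -/
def Transitive : Prop := ∀ (B : Fin S.m) (x y z : S.dom B),
  S.pred B x y = true → S.pred B y z = true → S.pred B x z = true

abbrev Tuple := (B : Fin S.m) → S.dom B

variable {S}

/-- The ordered pair `(t, t')` is a counterexample to the functional dependency. -/
def Counterexample (F : FuncDep S) (t t' : S.Tuple) : Prop :=
  (∀ B ∈ F.lhs, S.pred B (t B) (t' B) = true) ∧ S.pred F.rhs (t F.rhs) (t' F.rhs) ≠ true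

/-- Satisfaction with respect to the predicates. The pairs `(t, t)` count. -/
def Satisfies (F : FuncDep S) (s : Finset S.Tuple) : Prop :=
  ∀ t ∈ s, ∀ t' ∈ s, (∀ B ∈ F.lhs, S.pred B (t B) (t' B) = true) →
    S.pred F.rhs (t F.rhs) (t' F.rhs) = true

open Classical in
/-- The maximal cardinality of a subrelation of `r` that satisfies `F`. -/
noncomputable def maxSat (F : FuncDep S) (r : Finset S.Tuple) : ℕ :=
  (r.powerset.filter (Satisfies F)).sup Finset.card

/-- The `g₃`-error with predicates. -/
noncomputable def g3 (F : FuncDep S) (r : Finset S.Tuple) : ℝ :=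
  1 - (maxSat F r : ℝ) / (r.card : ℝ)

open Classical in
/-- The relation `r` without the tuples `t` such that `{t}` violates `F`. -/
noncomputable def removeSelfConflicts (F : FuncDep S) (r : Finset S.Tuple) : Finset S.Tuple :=
  r.filter fun t => Satisfies F {t}

/-! ### Representation of instances -/

/-- A tuple is given as the list of its values. -/
def codeTuple (t : S.Tuple) : Data :=
  Data.ofList (List.ofFn fun B => Data.ofBits ((S.code B).encode (t B)))

/-- `lhs` is given by its characteristic vector, `rhs` by its index. -/
def codeFD (F : FuncDep S) : Data :=
  Data.cons (Data.ofList (List.ofFn fun B => Data.ofBool (decide (B ∈ F.lhs))))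
    (Data.ofNat F.rhs)

variable (S) in
/-- The query "does the predicate of attribute `B` hold for `x` and `y`?" -/
def codeQuery (B : Fin S.m) (x y : S.dom B) : Data :=
  Data.cons (Data.ofNat B)
    (Data.cons (Data.ofBits ((S.code B).encode x)) (Data.ofBits ((S.code B).encode y)))

variable (S) in
/-- `O` evaluates the predicates of `S`, in time at most `q` of the size of the query. -/
def EvaluatedBy (q : Polynomial ℕ) (O : Oracle) : Prop :=
  ∀ (B : Fin S.m) (x y : S.dom B), O.answer (codeQuery S B x y) = S.pred B x y ∧
    O.time (codeQuery S B x y) ≤ q.eval (codeQuery S B x y).size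

end PredScheme

/-- A nonempty finite relation over a relation scheme with predicates, listed without repetition
in any order, and a functional dependency. -/
structure FDInstance where
  S : PredScheme.{u}
  F : FuncDep S
  rows : List S.Tuple
  nodup : rows.Nodup
  ne_nil : rows ≠ []

namespace FDInstance

/-- The relation, as a set of tuples. -/
def rel (I : FDInstance.{u}) : Finset I.S.Tuple := ⟨I.rows, I.nodup⟩

def input (I : FDInstance.{u}) : Data :=
  Data.cons (PredScheme.codeFD I.F) (Data.ofList (I.rows.map PredScheme.codeTuple))

end FDInstance

/-- Instances all of whose predicates are symmetric and transitive. -/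
abbrev SymTransInstance := {I : FDInstance.{u} // I.S.Symmetric ∧ I.S.Transitive}

/-- A graph without induced path on four vertices. -/
def IsCograph {V : Type*} (G : SimpleGraph V) : Prop :=
  IsEmpty (SimpleGraph.pathGraph 4 ↪g G)

/-!
Under symmetric and transitive predicates, "the predicates of `X` hold for `t`, `t'`" and "the
predicate of `A` holds for `t`, `t'`" are partial equivalence relations `E` and `D`, and a
counterexample is a pair in `E` but not in `D`. A tuple that is not `E`-related to itself is in no
counterexample. The other tuples fall into `E`-classes, between which there are no counterexamples,
and within an `E`-class a satisfying subrelation is contained in a single `D`-class. Hence a largest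
satisfying subrelation picks a largest `D`-class from each `E`-class
(`card_le_sum_classes`, `exists_card_eq_sum_classes`). In the same way, the middle edge of an
induced path on four vertices would join two `D`-related tuples (`exists_isCograph`).

To compute the size without forming the classes, number the tuples and let `c k` be the number of
tuples that are `E`-related and `D`-related to the tuple `k` (and `1` if `k` is not `E`-related to
itself). Within a class, the largest `c` is the sum of the truncated differences of `c k` and the
maximum of `c j` over the later `j` in the class, by telescoping. So `maxSat` is the sum of these
differences over all tuples (`FDInstance.maxSat_eq_sum`), which takes only nested loops over the
rows.

With `n` tuples and `M = maxSat`, the threshold `x / y` is met if and only if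
`(n - M) * y ≤ n * x`. As `n` and `M` are available in unary, this is decided by adding
`n * x - (n - M) * y` digit by digit, with a carry kept in unary and shifted so as to be a natural
number (`le_shiftedCarry_encodeNat_iff`).

Programs are never written down as a whole. `Family.Computes C a b` says that some program turns
`a i` into `b i` in time polynomial in the size of the instance `i`. This relation is closed under
composition, pairing, branching, queries and loops with a polynomially bounded loop variable, and
the algorithm is assembled from these rules. The number of a round becomes part of the instance
in the body of a loop, so that nested loops need no further rules, and so that a query in a loop is
known to be about values of the domain in question.
-/

universe v w

/-! ### Polynomial bounds -/

theorem Polynomial.eval_nat_mono (p : Polynomial ℕ) : Monotone fun n => p.eval n := by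
  intro m n h
  simp only [Polynomial.eval_eq_sum_range]
  gcongr

/-- A family of instances `i`, each with a size, in which running times and sizes of data are
measured, and with the admissible black boxes, as in `SolvableInPolyTime`. -/
structure Family (ι : Type v) where
  size : ι → ℕ
  box : ι → Polynomial ℕ → Oracle → Prop

namespace Family

variable {ι : Type v} {κ : Type w}

/-- The family with the instances `π k`. -/
def pull (C : Family ι) (π : κ → ι) : Family κ where
  size k := C.size (π k)
  box k := C.box (π k)

/-- The numbers `f i` are bounded by a polynomial in the size of the instance. -/
def Bounded (C : Family ι) (f : ι → ℕ) : Prop :=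
  ∃ p : Polynomial ℕ, ∀ i, f i ≤ p.eval (C.size i)

variable {C : Family ι} {f g : ι → ℕ}

namespace Bounded

theorem mono (hg : C.Bounded g) (h : ∀ i, f i ≤ g i) : C.Bounded f :=
  hg.imp fun _ hp i => (h i).trans (hp i)

theorem const (n : ℕ) : C.Bounded fun _ => n :=
  ⟨Polynomial.C n, fun i => by simp⟩

theorem self : C.Bounded C.size := ⟨Polynomial.X, fun i => by simp⟩

theorem add (hf : C.Bounded f) (hg : C.Bounded g) : C.Bounded fun i => f i + g i := by
  obtain ⟨p, hp⟩ := hf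
  obtain ⟨q, hq⟩ := hg
  exact ⟨p + q, fun i => by simpa using add_le_add (hp i) (hq i)⟩

theorem mul (hf : C.Bounded f) (hg : C.Bounded g) : C.Bounded fun i => f i * g i := by
  obtain ⟨p, hp⟩ := hf
  obtain ⟨q, hq⟩ := hg
  exact ⟨p * q, fun i => by simpa using Nat.mul_le_mul (hp i) (hq i)⟩

theorem eval (hf : C.Bounded f) (q : Polynomial ℕ) : C.Bounded fun i => q.eval (f i) := by
  obtain ⟨p, hp⟩ := hf
  exact ⟨q.comp p, fun i => by simpa using q.eval_nat_mono (hp i)⟩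

theorem pull (hf : C.Bounded f) (π : κ → ι) : (C.pull π).Bounded fun k => f (π k) :=
  hf.imp fun _ hp k => hp (π k)

theorem data_cons {a b : ι → Data} (ha : C.Bounded fun i => (a i).size)
    (hb : C.Bounded fun i => (b i).size) : C.Bounded fun i => (Data.cons (a i) (b i)).size :=
  (ha.add hb).add (const 1)

end Bounded

end Family

/-! ### Sizes of data -/

namespace Data

theorem one_le_size (a : Data) : 1 ≤ a.size := by
  cases a <;> simp [size]

theorem head_size_le (a : Data) : a.head.size ≤ a.size := by
  cases a <;> simp [head, size]; omega

theorem tail_size_le (a : Data) : a.tail.size ≤ a.size := by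
  cases a <;> simp [tail, size]; omega

theorem length_le_size (l : List Data) : l.length ≤ (ofList l).size := by
  induction l with
  | nil => simp
  | cons a l ih => simp only [List.length_cons, ofList, size]; omega

theorem size_drop_le (l : List Data) (k : ℕ) : (ofList (l.drop k)).size ≤ (ofList l).size := by
  induction l generalizing k with
  | nil => simp
  | cons a l ih =>
    cases k with
    | zero => simp
    | succ k => simp only [List.drop_succ_cons, ofList, size]; have := ih k; omega

theorem tail_ofList_drop (l : List Data) (k : ℕ) :
    (ofList (l.drop k)).tail = ofList (l.drop (k + 1)) := by
  rw [← List.drop_drop]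
  cases l.drop k <;> rfl

theorem head_ofList_drop (l : List Data) (k : ℕ) (hk : k < l.length) :
    (ofList (l.drop k)).head = l[k] := by
  rw [List.drop_eq_getElem_cons hk]; rfl

theorem ofBool_size_le (b : Bool) : (ofBool b).size ≤ 3 := by
  cases b <;> simp [ofBool, size]

theorem ofBool_ne_nil {b : Bool} : ofBool b ≠ nil ↔ b = true := by
  cases b <;> simp [ofBool]

theorem ofNat_zero : ofNat 0 = nil := rfl

theorem ofNat_succ (n : ℕ) : ofNat (n + 1) = cons nil (ofNat n) := rfl

theorem ofNat_size (n : ℕ) : (ofNat n).size = 2 * n + 1 := by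
  induction n with
  | zero => rfl
  | succ n ih => rw [ofNat_succ, size, ih, size]; ring

theorem tail_ofNat (n : ℕ) : (ofNat n).tail = ofNat (n - 1) := by
  cases n <;> rfl

end Data

/-! ### Programs as functions: composition, branching, queries and loops -/

namespace Family

variable {ι : Type v} {κ : Type w}

/-- There is a program that turns `a i` into `b i` in time polynomial in the size of `i`. The
program finds `a i` in variable `0` and leaves `b i` there. It makes no assumption on
the other variables and changes only finitely many of them, so that programs can be combined by
keeping data in variables beyond the bound `N`. -/
structure Computes (C : Family ι) (a b : ι → Data) : Prop where
  bounded_in : C.Bounded fun i => (a i).size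
  bounded_out : C.Bounded fun i => (b i).size
  exists_program : ∃ (P : Program) (N : ℕ), ∀ q : Polynomial ℕ, ∃ p : Polynomial ℕ,
    ∀ (i : ι) (O : Oracle), C.box i q O → ∀ σ : Store, σ 0 = a i →
      ∃ (τ : Store) (n : ℕ), Exec O P σ τ n ∧ τ 0 = b i ∧ (∀ j, N ≤ j → τ j = σ j) ∧
        n ≤ p.eval (C.size i)

theorem Computes.solvableInPolyTime {input output : ι → Data}
    {boxes : ι → Polynomial ℕ → Oracle → Prop}
    (h : Computes ⟨fun i => (input i).size, boxes⟩ input output) :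
    SolvableInPolyTime input output boxes := by
  obtain ⟨-, -, P, N, hP⟩ := h
  refine ⟨P, fun q => ?_⟩
  obtain ⟨p, hp⟩ := hP q
  refine ⟨p, fun i O hO => ?_⟩
  obtain ⟨τ, n, hex, hout, -, hn⟩ := hp i O hO (Function.update (fun _ => Data.nil) 0 (input i))
    (by simp)
  exact ⟨τ, n, hex, hout, hn⟩

variable {C : Family ι} {a b c d : ι → Data}

namespace Computes

theorem congr (h : C.Computes a b) {b' : ι → Data} (hb : ∀ i, b i = b' i) :
    C.Computes a b' := by
  rwa [← funext hb]

/-- Change of the instances: a program for the instances `i` also serves the instances `π k`, if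
these are not much larger than `k` and have the black boxes of `k`. -/
theorem pull (h : C.Computes a b) {K : Family κ} (π : κ → ι)
    (hsize : K.Bounded fun k => C.size (π k)) (hbox : ∀ k q O, K.box k q O → C.box (π k) q O) :
    K.Computes (fun k => a (π k)) (fun k => b (π k)) := by
  obtain ⟨⟨pa, ha⟩, ⟨pb, hb⟩, P, N, hP⟩ := h
  obtain ⟨s, hs⟩ := hsize
  have key : ∀ (p : Polynomial ℕ) k, p.eval (C.size (π k)) ≤ (p.comp s).eval (K.size k) := by
    intro p k
    simpa using p.eval_nat_mono (hs k)
  refine ⟨⟨pa.comp s, fun k => (ha _).trans (key _ _)⟩,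
    ⟨pb.comp s, fun k => (hb _).trans (key _ _)⟩, P, N, fun q => ?_⟩
  obtain ⟨p, hp⟩ := hP q
  refine ⟨p.comp s, fun k O hO σ hσ => ?_⟩
  obtain ⟨τ, n, h1, h2, h3, h4⟩ := hp (π k) O (hbox k q O hO) σ hσ
  exact ⟨τ, n, h1, h2, h3, h4.trans (key _ _)⟩

theorem id (ha : C.Bounded fun i => (a i).size) : C.Computes a a :=
  ⟨ha, ha, .skip, 0, fun _ => ⟨1, fun _ _ _ σ hσ => ⟨σ, 1, .skip σ, hσ, fun _ _ => rfl, by simp⟩⟩⟩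

theorem comp (h₁ : C.Computes a b) (h₂ : C.Computes b c) : C.Computes a c := by
  obtain ⟨ha, -, P, N, hP⟩ := h₁
  obtain ⟨-, hc, Q, M, hQ⟩ := h₂
  refine ⟨ha, hc, .seq P Q, max N M, fun q => ?_⟩
  obtain ⟨p, hp⟩ := hP q
  obtain ⟨r, hr⟩ := hQ q
  refine ⟨p + r, fun i O hO σ hσ => ?_⟩
  obtain ⟨τ, m, h1, h2, h3, h4⟩ := hp i O hO σ hσ
  obtain ⟨υ, n, k1, k2, k3, k4⟩ := hr i O hO τ h2
  refine ⟨υ, m + n, .seq h1 k1, k2, fun j hj => ?_, by simpa using add_le_add h4 k4⟩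
  rw [k3 j (le_trans (le_max_right _ _) hj), h3 j (le_trans (le_max_left _ _) hj)]

/-- Values given by an expression in variable `0`. -/
theorem of_expr (ha : C.Bounded fun i => (a i).size) (hb : C.Bounded fun i => (b i).size)
    (e : Expr) (he : ∀ i (σ : Store), σ 0 = a i → e.eval σ = b i)
    (hcost : C.Bounded f) (hf : ∀ i (σ : Store), σ 0 = a i → e.cost σ ≤ f i) :
    C.Computes a b := by
  refine ⟨ha, hb, .assign 0 e, 1, fun q => ?_⟩
  obtain ⟨p, hp⟩ := hcost
  refine ⟨1 + p, fun i O _ σ hσ => ⟨_, _, .assign σ 0 e, by simp [he i σ hσ], fun j hj => ?_, ?_⟩⟩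
  · rw [Function.update_of_ne (by omega)]
  · simpa using (hf i σ hσ).trans (hp i)

theorem nil (ha : C.Bounded fun i => (a i).size) : C.Computes a fun _ => .nil :=
  of_expr ha (.const 1) .nil (fun _ _ _ => rfl) (.const 1) fun _ _ _ => le_rfl

theorem head (h : C.Computes a b) : C.Computes a fun i => (b i).head := by
  refine h.comp (of_expr (f := fun i => (b i).size + (b i).size) h.bounded_out
    (h.bounded_out.mono fun i => (b i).head_size_le) (.head (.var 0)) ?_
    (h.bounded_out.add h.bounded_out) ?_)
  · intro i σ hσ
    simp [Expr.eval, hσ]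
  · intro i σ hσ
    simpa [Expr.eval, Expr.cost, hσ] using (b i).head_size_le

theorem tail (h : C.Computes a b) : C.Computes a fun i => (b i).tail := by
  refine h.comp (of_expr (f := fun i => (b i).size + (b i).size) h.bounded_out
    (h.bounded_out.mono fun i => (b i).tail_size_le) (.tail (.var 0)) ?_
    (h.bounded_out.add h.bounded_out) ?_)
  · intro i σ hσ
    simp [Expr.eval, hσ]
  · intro i σ hσ
    simpa [Expr.eval, Expr.cost, hσ] using (b i).tail_size_le

theorem cons (h₁ : C.Computes a b) (h₂ : C.Computes a c) :
    C.Computes a fun i => .cons (b i) (c i) := by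
  refine ⟨h₁.bounded_in, h₁.bounded_out.data_cons h₂.bounded_out, ?_⟩
  obtain ⟨⟨pa, ha⟩, ⟨pb, hb⟩, P, N, hP⟩ := h₁
  obtain ⟨-, ⟨pc, hc⟩, Q, M, hQ⟩ := h₂
  -- two variables that neither program touches: the first keeps the input, the second `b i`
  let K := max N M + 1
  refine ⟨.seq (.assign K (.var 0)) (.seq P (.seq (.assign (K + 1) (.var 0))
    (.seq (.assign 0 (.var K)) (.seq Q (.assign 0 (.cons (.var (K + 1)) (.var 0))))))), K + 2,
    fun q => ?_⟩
  obtain ⟨p, hp⟩ := hP q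
  obtain ⟨r, hr⟩ := hQ q
  refine ⟨5 + 2 * pa + 3 * pb + 2 * pc + p + r, fun i O hO σ hσ => ?_⟩
  obtain ⟨τ, m, h1, h2, h3, h4⟩ := hp i O hO (Function.update σ K (σ 0)) (by simp [K, hσ])
  have hτ : τ K = a i := by rw [h3 K (by omega)]; simp [hσ]
  obtain ⟨υ, n, k1, k2, k3, k4⟩ := hr i O hO
    (Function.update (Function.update τ (K + 1) (τ 0)) 0 (τ K)) (by simp [hτ])
  have hυ : υ (K + 1) = b i := by
    rw [k3 (K + 1) (by omega)]; simp [h2]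
  refine ⟨_, _, .seq (.assign _ _ _) (.seq h1 (.seq (.assign _ _ _) (.seq (.assign _ _ _)
    (.seq (?_ : Exec O Q _ υ n) (.assign _ _ _))))), ?_, ?_, ?_⟩
  · simpa [Expr.eval] using k1
  · simp [Expr.eval, k2, hυ]
  · intro j hj
    rw [Function.update_of_ne (by omega), k3 j (by omega), Function.update_of_ne (by omega),
      Function.update_of_ne (by omega), h3 j (by omega), Function.update_of_ne (by omega)]
  · have e1 := ha i
    have e2 := hb i
    have e3 := hc i
    simp [Expr.eval, Expr.cost, Data.size, k2, hυ, hσ, hτ, h2, K] at *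
    omega

/-- Choice between two values. Both of them are computed, so that neither program has to be
restricted to the instances for which its value is chosen. -/
theorem ite {p : ι → Prop} [DecidablePred p] (h : C.Computes a d) (hp : ∀ i, d i ≠ .nil ↔ p i)
    (h₁ : C.Computes a b) (h₂ : C.Computes a c) :
    C.Computes a fun i => if p i then b i else c i := by
  have h' := h.cons (h₁.cons h₂)
  refine h'.comp ⟨h'.bounded_out, (h₁.bounded_out.add h₂.bounded_out).mono fun i => ?_,
    .ite (.head (.var 0)) (.assign 0 (.head (.tail (.var 0)))) (.assign 0 (.tail (.tail (.var 0)))),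
    1, fun q => ?_⟩
  · split <;> omega
  obtain ⟨r, hr⟩ := h'.bounded_out
  refine ⟨2 + 6 * r, fun i O _ σ hσ => ?_⟩
  have hs := hr i
  have hd := (d i).one_le_size
  by_cases ht : p i
  · refine ⟨_, _, .ite_true (by simpa [Expr.eval, hσ, Data.head] using (hp i).2 ht)
      (.assign _ _ _), ?_, ?_, ?_⟩
    · simp [Expr.eval, hσ, Data.tail, Data.head, ht]
    · intro j hj
      rw [Function.update_of_ne (by omega)]
    · simp [Expr.eval, Expr.cost, hσ, Data.tail, Data.head, Data.size] at *
      omega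
  · refine ⟨_, _, .ite_false (by simpa [Expr.eval, hσ, Data.head] using mt (hp i).1 ht)
      (.assign _ _ _), ?_, ?_, ?_⟩
    · simp [Expr.eval, hσ, Data.tail, ht]
    · intro j hj
      rw [Function.update_of_ne (by omega)]
    · simp [Expr.eval, Expr.cost, hσ, Data.tail, Data.head, Data.size] at *
      omega

/-- Only the queries that are actually made have to be ones that the black box answers correctly
and fast. -/
theorem query {r : ι → Bool} (h : C.Computes a b)
    (hr : ∀ i q O, C.box i q O → O.answer (b i) = r i ∧ O.time (b i) ≤ q.eval (b i).size) :
    C.Computes a fun i => .ofBool (r i) := by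
  refine h.comp ⟨h.bounded_out, (Bounded.const 3).mono fun i => Data.ofBool_size_le _,
    .query 0 (.var 0), 1, fun q => ?_⟩
  obtain ⟨p, hp⟩ := h.bounded_out
  obtain ⟨p', hp'⟩ := h.bounded_out.eval q
  refine ⟨1 + p + p', fun i O hO σ hσ => ⟨_, _, .query _ _ _, ?_, ?_, ?_⟩⟩
  · simp [Expr.eval, hσ, (hr i q O hO).1]
  · intro j hj
    rw [Function.update_of_ne (by omega)]
  · have h1 := (hr i q O hO).2
    have h2 := hp i
    have h3 := hp' i
    simp [Expr.eval, Expr.cost, hσ] at *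
    omega

/-- Loops over a list. The value of the loop variable after `k` rounds is `acc i k`; the body sees
the environment `a i`, what remains of the list (beginning with the current entry), and the loop
variable. -/
theorem loop {l : ι → List Data} {acc : ι → ℕ → Data}
    (hl : C.Computes a fun i => .ofList (l i)) (h0 : C.Computes a fun i => acc i 0)
    (hbody : (C.pull (Sigma.fst : (Σ i, Fin (l i).length) → ι)).Computes
      (fun k => .cons (a k.1) (.cons (.ofList ((l k.1).drop k.2)) (acc k.1 k.2)))
      (fun k => acc k.1 (k.2 + 1))) :
    C.Computes a fun i => acc i (l i).length := by
  have h' := (id h0.bounded_in).cons (hl.cons h0)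
  obtain ⟨pz, hz⟩ := h0.bounded_out
  obtain ⟨⟨px, hx⟩, ⟨pb, hb⟩, B, N, hB⟩ := hbody
  -- the final value is the initial one or the result of a round
  have hout : ∀ i, (acc i (l i).length).size ≤ (pz + pb).eval (C.size i) := by
    intro i
    rw [Polynomial.eval_add]
    rcases Nat.eq_zero_or_pos (l i).length with h | h
    · rw [h]
      exact (hz i).trans (Nat.le_add_right _ _)
    · have := hb ⟨i, (l i).length - 1, by omega⟩
      simp only [Nat.sub_add_cancel h] at this
      exact this.trans (Nat.le_add_left _ _)
  refine h'.comp ⟨h'.bounded_out, ⟨_, hout⟩, ?_⟩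
  obtain ⟨pa, ha⟩ := h0.bounded_in
  obtain ⟨pl, hl⟩ := hl.bounded_out
  let K := N + 1
  refine ⟨.seq (.assign K (.head (.var 0))) (.seq (.assign (K + 1) (.head (.tail (.var 0))))
    (.seq (.assign 0 (.tail (.tail (.var 0))))
    (.while (.var (K + 1)) (.seq (.assign 0 (.cons (.var K) (.cons (.var (K + 1)) (.var 0))))
      (.seq B (.assign (K + 1) (.tail (.var (K + 1))))))))), K + 2, fun q => ?_⟩
  obtain ⟨p, hp⟩ := hB q
  let R := p + 6 + 3 * pa + 6 * pl + 4 * px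
  refine ⟨pl * R + (10 + 10 * (pa + pl + pz)), fun i O hO σ hσ => ?_⟩
  -- the remaining rounds, from any store as it is after `k` rounds
  have rounds : ∀ m k, k + m = (l i).length → ∀ σ : Store, σ 0 = acc i k → σ K = a i →
      σ (K + 1) = .ofList ((l i).drop k) → ∃ (τ : Store) (n : ℕ),
      Exec O (.while (.var (K + 1))
      (.seq (.assign 0 (.cons (.var K) (.cons (.var (K + 1)) (.var 0))))
      (.seq B (.assign (K + 1) (.tail (.var (K + 1))))))) σ τ n ∧ τ 0 = acc i (l i).length ∧
      (∀ j, K + 2 ≤ j → τ j = σ j) ∧ n ≤ m * R.eval (C.size i) + 2 := by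
    intro m
    induction m with
    | zero =>
      intro k hk σ h0 h1 h2
      obtain rfl : k = (l i).length := by omega
      rw [List.drop_length] at h2
      refine ⟨σ, _, .while_false (by simp [Expr.eval, h2, Data.ofList]), h0, fun _ _ => rfl, ?_⟩
      simp [Expr.cost, h2, Data.ofList, Data.size]
    | succ m ih =>
      intro k hk σ h0 h1 h2
      have hkl : k < (l i).length := by omega
      obtain ⟨τ, n, e1, e2, e3, e4⟩ := hp ⟨i, k, hkl⟩ O hO
        (Function.update σ 0 (.cons (a i) (.cons (.ofList ((l i).drop k)) (acc i k)))) (by simp)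
      have hτK : τ K = a i := by
        rw [e3 K (by omega), Function.update_of_ne (by omega), h1]
      have hτK1 : τ (K + 1) = .ofList ((l i).drop k) := by
        rw [e3 (K + 1) (by omega), Function.update_of_ne (by omega), h2]
      obtain ⟨υ, n', g1, g2, g3, g4⟩ := ih (k + 1) (by omega)
        (Function.update τ (K + 1) (.ofList ((l i).drop (k + 1))))
        (by rw [Function.update_of_ne (by omega), e2])
        (by rw [Function.update_of_ne (by omega), hτK]) (by simp)
      refine ⟨υ, _, .while_true ?_ (.seq (.assign _ _ _) (.seq (?_ : Exec O B _ τ n)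
        (.assign _ _ _))) (?_ : Exec O _ _ υ n'), g2, ?_, ?_⟩
      · rw [Expr.eval, h2, List.drop_eq_getElem_cons hkl]
        simp [Data.ofList]
      · simpa only [Expr.eval, h0, h1, h2] using e1
      · simpa [Expr.eval, hτK1, Data.tail_ofList_drop] using g1
      · intro j hj
        rw [g3 j hj, Function.update_of_ne (by omega), e3 j (by omega),
          Function.update_of_ne (by omega)]
      · have s1 : (a i).size ≤ _ := ha i
        have s2 := (Data.size_drop_le (l i) k).trans (hl i)
        have s3 := (Data.size_drop_le (l i) (k + 1)).trans (hl i)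
        have s4 := hx ⟨i, k, hkl⟩
        simp only [Data.size] at s4
        have s5 : R.eval (C.size i) = p.eval (C.size i) + 6 + 3 * pa.eval (C.size i) +
          6 * pl.eval (C.size i) + 4 * px.eval (C.size i) := by simp [R]
        simp only [Family.pull] at e4 s4
        rw [add_mul, one_mul]
        simp only [Expr.eval, Expr.cost, Data.size, hτK1, h0, h1, h2, Data.tail_ofList_drop]
        omega
  obtain ⟨τ, n, e1, e2, e3, e4⟩ := rounds (l i).length 0 (by omega)
    (Function.update (Function.update (Function.update σ K (a i)) (K + 1) (.ofList (l i))) 0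
      (acc i 0)) (by simp) (by simp [K]) (by simp)
  refine ⟨τ, _, .seq (.assign _ _ _) (.seq (.assign _ _ _) (.seq (.assign _ _ _)
    (?_ : Exec O _ _ τ n))), e2, ?_, ?_⟩
  · simpa [Expr.eval, hσ, Data.head, Data.tail, K] using e1
  · intro j hj
    rw [e3 j hj, Function.update_of_ne (by omega), Function.update_of_ne (by omega),
      Function.update_of_ne (by omega)]
  · have s1 := ha i
    have s2 := hl i
    have s3 := hz i
    have s4 := (Data.length_le_size (l i)).trans (hl i)
    have s5 := Nat.mul_le_mul_right (R.eval (C.size i)) s4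
    have s6 := (acc i 0).one_le_size
    simp only [Polynomial.eval_add, Polynomial.eval_mul]
    simp [Expr.eval, Expr.cost, Data.size, hσ, Data.head, Data.tail, K] at *
    omega

end Computes

end Family

/-! ### Unary arithmetic and bounded sums and suprema -/

namespace Family

variable {ι : Type v} {C : Family ι} {a : ι → Data}

theorem bounded_ofNat {f : ι → ℕ} : (C.Bounded fun i => (Data.ofNat (f i)).size) ↔ C.Bounded f := by
  simp only [Data.ofNat_size]
  exact ⟨fun h => h.mono fun i => by omega, fun h => ((Bounded.const 2).mul h).add (.const 1)⟩

/-- The instances of the body of a loop: an instance of the whole, and the number of a round. -/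
abbrev rounds (C : Family ι) (l : ι → List Data) : Family (Σ i, Fin (l i).length) :=
  C.pull Sigma.fst

namespace Computes

theorem lift {κ : Type w} {b : ι → Data} (h : C.Computes a b) (π : κ → ι) :
    (C.pull π).Computes (fun k => a (π k)) (fun k => b (π k)) :=
  h.pull π (.self) fun _ _ _ => _root_.id

/-- A form of `loop` in which the body may use the environment, the rest of the list and the loop
variable without knowing how they are stored. That the size of the loop variable stays polynomial
is a hypothesis, since rounds that are polynomial one by one can make it grow exponentially. -/
theorem loop_body {l : ι → List Data} {acc : ι → ℕ → Data}
    (hl : C.Computes a fun i => .ofList (l i)) (h0 : C.Computes a fun i => acc i 0)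
    (hacc : (C.rounds l).Bounded fun k => (acc k.1 k.2).size)
    (hbody : ∀ e, (C.rounds l).Computes e (fun k => a k.1) →
      (C.rounds l).Computes e (fun k => .ofList ((l k.1).drop k.2)) →
      (C.rounds l).Computes e (fun k => acc k.1 k.2) →
      (C.rounds l).Computes e (fun k => acc k.1 (k.2 + 1))) :
    C.Computes a fun i => acc i (l i).length := by
  refine loop hl h0 ?_
  have h := id (C := C.rounds l) (a := fun k =>
    .cons (a k.1) (.cons (.ofList ((l k.1).drop k.2)) (acc k.1 k.2))) <|
    (h0.bounded_in.pull _).data_cons <|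
    ((hl.bounded_out.pull _).mono fun k => Data.size_drop_le _ _).data_cons hacc
  exact hbody _ h.head h.tail.head h.tail.tail

theorem and {p q : ι → Bool} (hp : C.Computes a fun i => .ofBool (p i))
    (hq : C.Computes a fun i => .ofBool (q i)) : C.Computes a fun i => .ofBool (p i && q i) := by
  refine (ite (p := fun i => p i = true) hp (fun i => ?_) hq (.nil hp.bounded_in)).congr
    fun i => ?_
  · cases p i <;> simp [Data.ofBool]
  · cases p i <;> simp [Data.ofBool]

theorem zero (ha : C.Bounded fun i => (a i).size) : C.Computes a fun _ => .ofNat 0 :=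
  nil ha

theorem one (ha : C.Bounded fun i => (a i).size) : C.Computes a fun _ => .ofNat 1 :=
  (nil ha).cons (nil ha)

theorem isTrue (ha : C.Bounded fun i => (a i).size) : C.Computes a fun _ => .ofBool true :=
  (nil ha).cons (nil ha)

theorem bounded_length {l : ι → List Data} (hl : C.Computes a fun i => .ofList (l i)) :
    C.Bounded fun i => (l i).length :=
  hl.bounded_out.mono fun i => Data.length_le_size (l i)

theorem add_length {x : ι → ℕ} {l : ι → List Data} (hx : C.Computes a fun i => .ofNat (x i))
    (hl : C.Computes a fun i => .ofList (l i)) :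
    C.Computes a fun i => .ofNat (x i + (l i).length) := by
  refine loop_body (acc := fun i k => .ofNat (x i + k)) hl hx ?_ fun e _ _ h => ?_
  · rw [bounded_ofNat]
    exact (((bounded_ofNat.1 hx.bounded_out).add hl.bounded_length).pull _).mono
      fun k => by have := k.2.2; omega
  · exact (nil h.bounded_in).cons h

/-- Truncated subtraction. -/
theorem sub_length {x : ι → ℕ} {l : ι → List Data} (hx : C.Computes a fun i => .ofNat (x i))
    (hl : C.Computes a fun i => .ofList (l i)) :
    C.Computes a fun i => .ofNat (x i - (l i).length) := by
  refine loop_body (acc := fun i k => .ofNat (x i - k)) hl hx ?_ fun e _ _ h => ?_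
  · rw [bounded_ofNat]
    exact ((bounded_ofNat.1 hx.bounded_out).pull _).mono fun k => Nat.sub_le _ _
  · exact h.tail.congr fun k => by rw [Data.tail_ofNat, Nat.sub_sub]

theorem length {l : ι → List Data} (hl : C.Computes a fun i => .ofList (l i)) :
    C.Computes a fun i => .ofNat (l i).length :=
  ((zero hl.bounded_in).add_length hl).congr fun i => by rw [Nat.zero_add]

theorem add {x y : ι → ℕ} (hx : C.Computes a fun i => .ofNat (x i))
    (hy : C.Computes a fun i => .ofNat (y i)) : C.Computes a fun i => .ofNat (x i + y i) :=
  (hx.add_length hy).congr fun i => by rw [List.length_replicate]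

theorem sub {x y : ι → ℕ} (hx : C.Computes a fun i => .ofNat (x i))
    (hy : C.Computes a fun i => .ofNat (y i)) : C.Computes a fun i => .ofNat (x i - y i) :=
  (hx.sub_length hy).congr fun i => by rw [List.length_replicate]

/-- The maximum is `x + (y - x)`, with truncated subtraction. -/
theorem max {x y : ι → ℕ} (hx : C.Computes a fun i => .ofNat (x i))
    (hy : C.Computes a fun i => .ofNat (y i)) :
    C.Computes a fun i => .ofNat (Max.max (x i) (y i)) :=
  (hx.add (hy.sub hx)).congr fun i => by congr 1; omega

theorem lt {x y : ι → ℕ} (hx : C.Computes a fun i => .ofNat (x i))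
    (hy : C.Computes a fun i => .ofNat (y i)) :
    C.Computes a fun i => .ofBool (decide (x i < y i)) := by
  refine (ite (p := fun i => x i < y i) (hy.sub hx) (fun i => ?_) (isTrue hx.bounded_in)
    (nil hx.bounded_in)).congr fun i => ?_
  · rw [← Nat.sub_pos_iff_lt]
    cases y i - x i <;> simp [Data.ofNat_zero, Data.ofNat_succ]
  · by_cases h : x i < y i <;> simp [h, Data.ofBool]

/-- The loop variable is a pair of numbers with sum `k`, the smaller one first. -/
theorem half {x : ι → ℕ} (hx : C.Computes a fun i => .ofNat (x i)) :
    C.Computes a fun i => .ofNat (x i / 2) := by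
  have ha := hx.bounded_in
  have h := loop_body (acc := fun i k => .cons (.ofNat (k / 2)) (.ofNat ((k + 1) / 2))) hx
    (((zero ha).cons (zero ha)).congr fun i => by simp) ?_ fun e _ _ h => ?_
  · exact h.head.congr fun i => by simp [Data.head]
  · refine .data_cons (bounded_ofNat.2 ?_) (bounded_ofNat.2 ?_) <;>
    exact ((hx.bounded_length).pull _).mono fun k => by have := k.2.2; omega
  · refine (h.tail.cons ((nil h.bounded_in).cons h.head)).congr fun k => ?_
    simp only [Data.tail, Data.head]
    rw [← Data.ofNat_succ, show (k.2.1 + 1 + 1) / 2 = k.2.1 / 2 + 1 by omega]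

theorem bounded_rounds {l : ι → List Data} (hl : C.Computes a fun i => .ofList (l i))
    {f : (Σ i, Fin (l i).length) → ℕ}
    (hf : ∀ e, (C.rounds l).Computes e (fun k => a k.1) →
      (C.rounds l).Computes e (fun k => .ofList ((l k.1).drop k.2)) →
      (C.rounds l).Computes e (fun k => .ofNat (f k))) :
    ∃ p : Polynomial ℕ, ∀ i j, f ⟨i, j⟩ ≤ p.eval (C.size i) := by
  have h := id (C := C.rounds l) (a := fun k => .cons (a k.1) (.ofList ((l k.1).drop k.2))) <|
    (hl.bounded_in.pull _).data_cons
      ((hl.bounded_out.pull _).mono fun k => Data.size_drop_le _ _)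
  obtain ⟨p, hp⟩ := bounded_ofNat.1 (hf _ h.head h.tail).bounded_out
  exact ⟨p, fun i j => hp ⟨i, j⟩⟩

/-- Sums over the entries of a list, each term of which may depend on the list from its entry on. -/
theorem sum {l : ι → List Data} (hl : C.Computes a fun i => .ofList (l i))
    {f : (Σ i, Fin (l i).length) → ℕ}
    (hf : ∀ e, (C.rounds l).Computes e (fun k => a k.1) →
      (C.rounds l).Computes e (fun k => .ofList ((l k.1).drop k.2)) →
      (C.rounds l).Computes e (fun k => .ofNat (f k))) :
    C.Computes a fun i => .ofNat (∑ j, f ⟨i, j⟩) := by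
  have ha := hl.bounded_in
  obtain ⟨p, hp⟩ := bounded_rounds hl hf
  have h := loop_body (acc := fun i k =>
    .ofNat (∑ j : Fin (l i).length with j.val < k, f ⟨i, j⟩)) hl ?_ ?_ fun e h1 h2 h3 => ?_
  · exact h.congr fun i => by simp
  · exact (zero ha).congr fun i => by simp
  · rw [bounded_ofNat]
    refine ((hl.bounded_length.mul (Bounded.eval (C := C) .self p)).pull _).mono fun k => ?_
    refine (Finset.sum_le_card_nsmul _ _ _ fun j _ => hp k.1 j).trans ?_
    rw [smul_eq_mul]
    refine Nat.mul_le_mul_right _ ((Finset.card_filter_le _ _).trans (by simp))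
  · refine ((hf e h1 h2).add h3).congr fun k => ?_
    congr 1
    rw [← Finset.sum_insert (s := Finset.univ.filter fun j : Fin (l k.1).length => j.val < k.2)
      (a := k.2) (f := fun j => f ⟨k.1, j⟩) (by simp)]
    congr 1
    ext j
    simp [Fin.ext_iff]
    omega

/-- Suprema over the entries of a list, in the same manner. -/
theorem sup {l : ι → List Data} (hl : C.Computes a fun i => .ofList (l i))
    {f : (Σ i, Fin (l i).length) → ℕ}
    (hf : ∀ e, (C.rounds l).Computes e (fun k => a k.1) →
      (C.rounds l).Computes e (fun k => .ofList ((l k.1).drop k.2)) →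
      (C.rounds l).Computes e (fun k => .ofNat (f k))) :
    C.Computes a fun i => .ofNat (Finset.univ.sup fun j => f ⟨i, j⟩) := by
  have ha := hl.bounded_in
  obtain ⟨p, hp⟩ := bounded_rounds hl hf
  have h := loop_body (acc := fun i k =>
    .ofNat ((Finset.univ.filter fun j : Fin (l i).length => j.val < k).sup fun j => f ⟨i, j⟩))
    hl ?_ ?_ fun e h1 h2 h3 => ?_
  · exact h.congr fun i => by simp
  · exact (zero ha).congr fun i => by simp
  · rw [bounded_ofNat]
    refine ((Bounded.eval (C := C) .self p).pull _).mono fun k => ?_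
    exact Finset.sup_le fun j _ => hp k.1 j
  · refine ((hf e h1 h2).max h3).congr fun k => ?_
    congr 1
    rw [← Finset.sup_insert
      (s := Finset.univ.filter fun j : Fin (l k.1).length => j.val < k.2)
      (b := k.2) (f := fun j => f ⟨k.1, j⟩)]
    congr 1
    ext j
    simp [Fin.ext_iff]
    omega

end Computes

end Family

/-! ### Evaluation of the two sides of a functional dependency -/

open PredScheme

/-- The predicates of the left-hand side hold for `t` and `t'`. -/
def FuncDep.lhsAgree {S : PredScheme.{u}} (F : FuncDep S) (t t' : S.Tuple) : Bool :=
  decide (∀ B ∈ F.lhs, S.pred B (t B) (t' B) = true)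

/-- The predicate of the right-hand side holds for `t` and `t'`. -/
def FuncDep.rhsAgree {S : PredScheme.{u}} (F : FuncDep S) (t t' : S.Tuple) : Bool :=
  S.pred F.rhs (t F.rhs) (t' F.rhs)

/-- Two tuples over the same scheme, to be compared under a functional dependency. -/
structure TuplePair where
  S : PredScheme.{u}
  F : FuncDep S
  fst : S.Tuple
  snd : S.Tuple

namespace TuplePair

/-- The data that determine a comparison: the functional dependency and both tuples. -/
def code (p : TuplePair.{u}) : Data :=
  .cons (codeFD p.F) (.cons (codeTuple p.fst) (codeTuple p.snd))

/-- Comparisons as instances, with the black boxes that evaluate the predicates. -/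
def family : Family TuplePair.{u} where
  size p := p.code.size
  box p := p.S.EvaluatedBy

theorem computes_code : family.Computes code code := .id .self

/-- The encoded values of a tuple. -/
def values {S : PredScheme.{u}} (t : S.Tuple) : List Data :=
  List.ofFn fun B => Data.ofBits ((S.code B).encode (t B))

theorem head_drop_values {S : PredScheme.{u}} (t : S.Tuple) (B : Fin S.m) :
    (Data.ofList ((values t).drop B)).head = .ofBits ((S.code B).encode (t B)) := by
  rw [Data.head_ofList_drop _ _ (by simp [values])]
  simp [values]

theorem size_drop_values_le (p : TuplePair.{u}) (k : ℕ) :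
    (Data.ofList ((values p.fst).drop k)).size ≤ p.code.size ∧
      (Data.ofList ((values p.snd).drop k)).size ≤ p.code.size := by
  have h1 := Data.size_drop_le (values p.fst) k
  have h2 := Data.size_drop_le (values p.snd) k
  have h : p.code.size = (codeFD p.F).size + ((Data.ofList (values p.fst)).size +
    (Data.ofList (values p.snd)).size + 1) + 1 := rfl
  omega

theorem computes_rhsAgree :
    family.{u}.Computes code fun p => .ofBool (p.F.rhsAgree p.fst p.snd) := by
  have hc := computes_code.{u}
  -- drop the values of the attributes before the one in question
  have h := Family.Computes.loop_body
    (l := fun p : TuplePair.{u} => List.replicate p.F.rhs Data.nil)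
    (acc := fun p k => .cons (.ofList ((values p.fst).drop k)) (.ofList ((values p.snd).drop k)))
    hc.head.tail (hc.tail.head.cons hc.tail.tail) ?_ fun e _ _ h => ?_
  · have h' : family.{u}.Computes code fun p =>
        codeQuery p.S p.F.rhs (p.fst p.F.rhs) (p.snd p.F.rhs) := by
      refine (hc.head.tail.cons (h.head.head.cons h.tail.head)).congr fun p => ?_
      rw [List.length_replicate]
      exact congrArg₂ _ rfl (congrArg₂ _ (head_drop_values _ _) (head_drop_values _ _))
    exact h'.query fun p q O hO => hO _ _ _
  · exact ((Family.Bounded.self (C := family.{u})).pull _).mono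
      (fun k => (size_drop_values_le _ _).1)
      |>.data_cons <| ((Family.Bounded.self (C := family.{u})).pull _).mono
        fun k => (size_drop_values_le _ _).2
  · exact (h.head.tail.cons h.tail.tail).congr fun k =>
      congrArg₂ _ (Data.tail_ofList_drop _ _) (Data.tail_ofList_drop _ _)

/-- Run through the characteristic vector of the left-hand side. The loop variable holds the index
of the attribute, the remaining values of both tuples, and the result so far. -/
theorem computes_lhsAgree :
    family.{u}.Computes code fun p => .ofBool (p.F.lhsAgree p.fst p.snd) := by
  have hc := computes_code.{u}
  let l : TuplePair.{u} → List Data := fun p =>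
    List.ofFn fun B => Data.ofBool (decide (B ∈ p.F.lhs))
  have hl : ∀ p, (l p).length = p.S.m := fun p => List.length_ofFn
  have hl' : family.{u}.Computes code fun p => .ofList (l p) := hc.head.head
  have h := Family.Computes.loop_body (l := l)
    (acc := fun p k => .cons (.ofNat k) (.cons (.ofList ((values p.fst).drop k))
      (.cons (.ofList ((values p.snd).drop k)) (.ofBool (decide
        (∀ B ∈ p.F.lhs, B.val < k → p.S.pred B (p.fst B) (p.snd B) = true))))))
    hl' ?_ ?_ fun e _ hrest h => ?_
  · refine h.tail.tail.tail.congr fun p => ?_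
    simp [Data.tail, FuncDep.lhsAgree, hl]
  · refine ((Family.Computes.zero hc.bounded_in).cons (hc.tail.head.cons (hc.tail.tail.cons
      (.isTrue hc.bounded_in)))).congr fun p => ?_
    simp only [Nat.not_lt_zero, false_imp_iff, implies_true, decide_true]
    rfl
  · refine .data_cons (Family.bounded_ofNat.2 ((hl'.bounded_length.pull _).mono
      fun k => k.2.2.le)) (.data_cons ?_ (.data_cons ?_ ((Family.Bounded.const 3).mono
      fun k => Data.ofBool_size_le _)))
    · exact ((Family.Bounded.self (C := family.{u})).pull _).mono
        fun k => (size_drop_values_le _ _).1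
    · exact ((Family.Bounded.self (C := family.{u})).pull _).mono
        fun k => (size_drop_values_le _ _).2
  · let B : (k : Σ p, Fin (l p).length) → Fin k.1.S.m := fun k => Fin.cast (hl k.1) k.2
    have hmem : (family.{u}.rounds l).Computes e fun k => .ofBool (decide (B k ∈ k.1.F.lhs)) := by
      refine hrest.head.congr fun k => ?_
      rw [Data.head_ofList_drop _ _ k.2.2]
      simp [l, B, Fin.cast]
    have hq : (family.{u}.rounds l).Computes e fun k =>
        codeQuery k.1.S (B k) (k.1.fst (B k)) (k.1.snd (B k)) :=
      (h.head.cons (h.tail.head.head.cons h.tail.tail.head.head)).congr fun k =>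
        congrArg₂ _ rfl (congrArg₂ _ (head_drop_values _ (B k)) (head_drop_values _ (B k)))
    have hr := hq.query (r := fun k => k.1.S.pred (B k) (k.1.fst (B k)) (k.1.snd (B k)))
      fun k q O hO => hO _ _ _
    have hstep := (hmem.ite (p := fun k => B k ∈ k.1.F.lhs) (fun k => by
      by_cases h : B k ∈ k.1.F.lhs <;> simp [h, Data.ofBool]) hr (.isTrue h.bounded_in))
    have hstep' : (family.{u}.rounds l).Computes e fun k => .ofBool (decide (B k ∈ k.1.F.lhs →
        k.1.S.pred (B k) (k.1.fst (B k)) (k.1.snd (B k)) = true)) :=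
      hstep.congr fun k => by by_cases h : B k ∈ k.1.F.lhs <;> simp [h]
    refine (((Family.Computes.nil h.bounded_in).cons h.head).cons (h.tail.head.tail.cons
      (h.tail.tail.head.tail.cons (h.tail.tail.tail.and hstep')))).congr fun k => ?_
    refine congrArg₂ _ rfl (congrArg₂ _ (Data.tail_ofList_drop _ _) (congrArg₂ _
      (Data.tail_ofList_drop _ _) (congrArg _ ?_)))
    rw [Bool.eq_iff_iff]
    simp only [Bool.and_eq_true, decide_eq_true_eq]
    constructor
    · rintro ⟨h1, h2⟩ A hA hAk
      rcases Nat.lt_succ_iff_lt_or_eq.1 hAk with h | h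
      · exact h1 A hA h
      · obtain rfl : A = B k := Fin.ext h
        exact h2 hA
    · exact fun h => ⟨fun A hA hAk => h A hA (Nat.lt_succ_of_lt hAk),
        fun hB => h _ hB (Nat.lt_succ_self _)⟩

end TuplePair

/-! ### Largest satisfying subrelations under partial equivalence relations -/

section Combinatorics

/-- Telescoping: each element contributes what it adds to the maximum over the later ones. -/
theorem sum_sub_sup_later {α : Type*} [LinearOrder α] (c : α → ℕ) (Q : Finset α) :
    ∑ k ∈ Q, (c k - (Q.filter fun j => k < j).sup c) = Q.sup c := by
  refine Finset.induction_on_min Q (by simp) fun a s ha ih => ?_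
  have has : a ∉ s := fun h => lt_irrefl _ (ha a h)
  rw [Finset.sum_insert has, Finset.sup_insert]
  have h1 : (insert a s).filter (fun j => a < j) = s := by
    ext j
    simp only [Finset.mem_filter, Finset.mem_insert]
    exact ⟨fun h => h.1.resolve_left h.2.ne', fun h => ⟨.inr h, ha j h⟩⟩
  have h2 : ∀ k ∈ s, (insert a s).filter (fun j => k < j) = s.filter fun j => k < j := by
    intro k hk
    rw [Finset.filter_insert, if_neg (ha k hk).not_gt]
  rw [h1, Finset.sum_congr rfl fun k hk => by rw [h2 k hk], ih]
  change _ = Max.max _ _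
  omega

/-- Symmetric and transitive Boolean relations, that is, partial equivalence relations. -/
structure IsPER {α : Type*} (E : α → α → Bool) : Prop where
  symm : ∀ {i j}, E i j = true → E j i = true
  trans : ∀ {i j k}, E i j = true → E j k = true → E i k = true

theorem IsPER.refl_left {α : Type*} {E : α → α → Bool} (hE : IsPER E) {i j : α}
    (h : E i j = true) : E i i = true :=
  hE.trans h (hE.symm h)

variable {α : Type*} [Fintype α] [DecidableEq α]

/-- The elements that a set without conflicts (that is, on which `E` implies `D`) can have in the
class of `k` if `k` is one of them. An element not related to itself forms a class of its own and
is in no conflict. The set is empty if `k` is in conflict with itself. -/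
def compatible (E D : α → α → Bool) (k : α) : Finset α :=
  if E k k then Finset.univ.filter fun u => (E k u && D k u) = true else {k}

/-- The class of `k` under the equivalence relation generated by `E`. -/
def eqvClass (E : α → α → Bool) (k : α) : Finset α :=
  Finset.univ.filter fun j => j = k ∨ E k j = true

variable {E D : α → α → Bool} {i j k : α}

theorem mem_eqvClass : j ∈ eqvClass E k ↔ j = k ∨ E k j = true := by
  simp [eqvClass]

theorem eqvClass_eq_iff (hE : IsPER E) : eqvClass E j = eqvClass E k ↔ j ∈ eqvClass E k := by
  constructor
  · intro h
    rw [← h, mem_eqvClass]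
    exact .inl rfl
  · intro h
    rcases mem_eqvClass.1 h with rfl | h
    · rfl
    · ext i
      simp only [mem_eqvClass]
      constructor
      · rintro (rfl | h')
        · exact .inr h
        · exact .inr (hE.trans h h')
      · rintro (rfl | h')
        · exact .inr (hE.symm h)
        · exact .inr (hE.trans (hE.symm h) h')

theorem compatible_subset : compatible E D k ⊆ eqvClass E k := by
  intro j hj
  rw [mem_eqvClass]
  unfold compatible at hj
  split at hj
  · simp only [Finset.mem_filter, Bool.and_eq_true] at hj
    exact .inr hj.2.1
  · exact .inl (by simpa using hj)

/-- The left-hand side refers to the order of the elements but not to the classes, which makes it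
easy to compute; the right-hand side is the sum over the classes of the largest weight. -/
theorem sum_later_eq_sum_classes {α : Type*} [Fintype α] [LinearOrder α] {E : α → α → Bool}
    (hE : IsPER E) (c : α → ℕ) :
    ∑ k, (c k - Finset.univ.sup fun j => if k < j ∧ E k j = true then c j else 0) =
      ∑ Q ∈ Finset.univ.image (eqvClass E), Q.sup c := by
  rw [← Finset.sum_fiberwise_of_maps_to (s := Finset.univ) (g := eqvClass E)
    (t := Finset.univ.image (eqvClass E)) fun k _ => Finset.mem_image_of_mem _ (Finset.mem_univ k)]
  refine Finset.sum_congr rfl fun Q hQ => ?_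
  obtain ⟨a, -, rfl⟩ := Finset.mem_image.1 hQ
  have h1 : (Finset.univ.filter fun k => eqvClass E k = eqvClass E a) = eqvClass E a := by
    ext k
    simp [eqvClass_eq_iff hE]
  rw [h1, ← sum_sub_sup_later]
  refine Finset.sum_congr rfl fun k hk => ?_
  congr 1
  rw [← (eqvClass_eq_iff hE).2 hk]
  apply le_antisymm
  · refine Finset.sup_le fun j _ => ?_
    split
    · rename_i h
      exact Finset.le_sup (f := c) (by simp [mem_eqvClass, h.1, h.2])
    · exact Nat.zero_le _
  · refine Finset.sup_le fun j hj => ?_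
    simp only [Finset.mem_filter, mem_eqvClass] at hj
    have h : k < j ∧ E k j = true := ⟨hj.2, hj.1.resolve_left hj.2.ne'⟩
    refine le_trans ?_ (Finset.le_sup (f := fun j => if k < j ∧ E k j = true then c j else 0)
      (Finset.mem_univ j))
    simp [h]

/-- A set without conflicts meets each class in elements compatible with any one of them. -/
theorem card_le_sum_classes (hE : IsPER E) {s : Finset α}
    (hs : ∀ i ∈ s, ∀ j ∈ s, E i j = true → D i j = true) :
    s.card ≤ ∑ Q ∈ Finset.univ.image (eqvClass E), Q.sup fun k => (compatible E D k).card := by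
  rw [Finset.card_eq_sum_card_fiberwise (f := eqvClass E) (s := s)
    (t := Finset.univ.image (eqvClass E))
    fun k _ => Finset.mem_coe.2 (Finset.mem_image_of_mem _ (Finset.mem_univ k))]
  refine Finset.sum_le_sum fun Q _ => ?_
  rcases Finset.eq_empty_or_nonempty (s.filter fun i => eqvClass E i = Q) with h | ⟨k, hk⟩
  · simp [h]
  simp only [Finset.mem_filter] at hk
  obtain ⟨hks, rfl⟩ := hk
  have h1 : (s.filter fun i => eqvClass E i = eqvClass E k) ⊆ compatible E D k := by
    intro j hj
    simp only [Finset.mem_filter, eqvClass_eq_iff hE, mem_eqvClass] at hj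
    unfold compatible
    split
    · rename_i hkk
      have h : E k j = true := hj.2.elim (fun h => h ▸ hkk) _root_.id
      simp [h, hs k hks j hj.1 h]
    · rename_i hkk
      simpa using hj.2.resolve_right fun h => hkk (hE.refl_left h)
  exact (Finset.card_le_card h1).trans
    (Finset.le_sup (f := fun k => (compatible E D k).card) (mem_eqvClass.2 (.inl rfl)))

/-- Choose in each class an element with the largest number of compatible elements, and collect
these. -/
theorem exists_card_eq_sum_classes (hE : IsPER E) (hD : IsPER D) :
    ∃ s : Finset α, (∀ i ∈ s, ∀ j ∈ s, E i j = true → D i j = true) ∧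
      s.card = ∑ Q ∈ Finset.univ.image (eqvClass E), Q.sup fun k => (compatible E D k).card := by
  have h1 : ∀ Q ∈ Finset.univ.image (eqvClass E), ∃ k, eqvClass E k = Q ∧
      (compatible E D k).card = Q.sup fun k => (compatible E D k).card := by
    intro Q hQ
    obtain ⟨a, -, rfl⟩ := Finset.mem_image.1 hQ
    obtain ⟨k, hk, h⟩ := Finset.exists_mem_eq_sup (eqvClass E a)
      ⟨a, mem_eqvClass.2 (.inl rfl)⟩ fun k => (compatible E D k).card
    exact ⟨k, (eqvClass_eq_iff hE).2 hk, h.symm⟩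
  rcases isEmpty_or_nonempty α with _ | _
  · exact ⟨∅, by simp, by simp [Finset.univ_eq_empty]⟩
  choose! g hg hcard using h1
  refine ⟨(Finset.univ.image (eqvClass E)).biUnion fun Q => compatible E D (g Q), ?_, ?_⟩
  · intro i hi j hj hij
    obtain ⟨Q, hQ, hi⟩ := Finset.mem_biUnion.1 hi
    obtain ⟨Q', hQ', hj⟩ := Finset.mem_biUnion.1 hj
    -- related elements lie in the same class, hence are compatible with the same element
    have hQQ : Q = Q' := by
      rw [← hg Q hQ, ← hg Q' hQ', ← (eqvClass_eq_iff hE).2 (compatible_subset hi),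
        ← (eqvClass_eq_iff hE).2 (compatible_subset hj), eq_comm, eqvClass_eq_iff hE, mem_eqvClass]
      exact .inr hij
    subst hQQ
    unfold compatible at hi hj
    split at hi
    · rename_i h
      simp only [h, if_true, Finset.mem_filter, Bool.and_eq_true] at hi hj
      exact hD.trans (hD.symm hi.2.2) hj.2.2
    · rename_i h
      rw [Finset.mem_singleton] at hi
      exact absurd (hE.refl_left hij) (hi ▸ h)
  · rw [Finset.card_biUnion]
    · exact Finset.sum_congr rfl fun Q hQ => hcard Q hQ
    · intro Q hQ Q' hQ' hne
      rw [Function.onFun, Finset.disjoint_left]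
      intro i hi hi'
      apply hne
      rw [← hg Q hQ, ← hg Q' hQ', ← (eqvClass_eq_iff hE).2 (compatible_subset hi),
        ← (eqvClass_eq_iff hE).2 (compatible_subset hi')]

end Combinatorics


namespace FDInstance

variable (I : FDInstance.{u})

/-- Whether the left-hand side predicates relate two rows. -/
def lhsRel (i j : Fin I.rows.length) : Bool := I.F.lhsAgree I.rows[i] I.rows[j]

/-- Whether the right-hand side predicate relates two rows. -/
def rhsRel (i j : Fin I.rows.length) : Bool := I.F.rhsAgree I.rows[i] I.rows[j]

/-- The number of rows that a satisfying subrelation with row `k` can have in its class. -/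
def weight (k : Fin I.rows.length) : ℕ :=
  if I.lhsRel k k = true then ∑ u, if (I.lhsRel k u && I.rhsRel k u) = true then 1 else 0 else 1

variable {I}

theorem card_compatible (k : Fin I.rows.length) :
    (compatible I.lhsRel I.rhsRel k).card = I.weight k := by
  unfold compatible weight
  split
  · rw [Finset.card_filter]
  · simp

theorem isPER_lhsRel (hs : I.S.Symmetric) (ht : I.S.Transitive) : IsPER I.lhsRel where
  symm h := by
    simp only [lhsRel, FuncDep.lhsAgree, decide_eq_true_eq] at *
    exact fun B hB => hs B _ _ ▸ h B hB
  trans h h' := by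
    simp only [lhsRel, FuncDep.lhsAgree, decide_eq_true_eq] at *
    exact fun B hB => ht B _ _ _ (h B hB) (h' B hB)

theorem isPER_rhsRel (hs : I.S.Symmetric) (ht : I.S.Transitive) : IsPER I.rhsRel where
  symm h := (hs _ _ _).trans h
  trans h h' := ht _ _ _ _ h h'

theorem satisfies_map_iff (f : Fin I.rows.length ↪ I.S.Tuple) (hf : ∀ i, f i = I.rows[i])
    (s : Finset (Fin I.rows.length)) : Satisfies I.F (s.map f) ↔
      ∀ i ∈ s, ∀ j ∈ s, I.lhsRel i j = true → I.rhsRel i j = true := by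
  simp [Satisfies, lhsRel, rhsRel, FuncDep.lhsAgree, FuncDep.rhsAgree, hf]

theorem maxSat_eq_sum (hs : I.S.Symmetric) (ht : I.S.Transitive) :
    maxSat I.F I.rel = ∑ k, (I.weight k -
      Finset.univ.sup fun j => if k < j ∧ I.lhsRel k j = true then I.weight j else 0) := by
  classical
  have hE := isPER_lhsRel hs ht
  let f : Fin I.rows.length ↪ I.S.Tuple :=
    ⟨fun i => I.rows[i], List.nodup_iff_injective_get.1 I.nodup⟩
  have hrel : I.rel = Finset.univ.map f := by
    ext t
    change t ∈ I.rows ↔ _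
    simp only [Finset.mem_map, Finset.mem_univ, true_and, List.mem_iff_get]
    rfl
  rw [sum_later_eq_sum_classes hE, ← funext card_compatible]
  apply le_antisymm
  · refine Finset.sup_le fun s hs => ?_
    simp only [Finset.mem_filter, Finset.mem_powerset] at hs
    obtain ⟨s', -, rfl⟩ := Finset.subset_map_iff.1 (hrel ▸ hs.1)
    rw [Finset.card_map]
    exact card_le_sum_classes hE ((satisfies_map_iff f (fun _ => rfl) s').1 hs.2)
  · obtain ⟨s, h1, h2⟩ := exists_card_eq_sum_classes hE (isPER_rhsRel hs ht)
    rw [← h2, ← Finset.card_map f]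
    refine Finset.le_sup (f := Finset.card) ?_
    simp only [Finset.mem_filter, Finset.mem_powerset]
    refine ⟨?_, (satisfies_map_iff f (fun _ => rfl) s).2 h1⟩
    rw [hrel]
    exact Finset.map_subset_map.2 (Finset.subset_univ s)

end FDInstance

namespace PredScheme

variable {S : PredScheme.{u}}

/-- The endpoints of an induced path on four vertices would be related by the predicate of the
right-hand side through `a`, `c` and through `a`, `d`, `b`, although `b` and `c` are adjacent. -/
theorem exists_isCograph (hs : S.Symmetric) (ht : S.Transitive) (F : FuncDep S)
    (r : Finset S.Tuple) : ∃ G : SimpleGraph {t // t ∈ removeSelfConflicts F r},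
      (∀ t t', G.Adj t t' ↔ Counterexample F t.val t'.val) ∧ IsCograph G := by
  classical
  refine ⟨⟨fun t t' => Counterexample F t.val t'.val, ⟨?_⟩, ⟨?_⟩⟩, fun _ _ => Iff.rfl,
    ⟨fun f => ?_⟩⟩
  · rintro t t' ⟨h1, h2⟩
    exact ⟨fun B hB => hs B _ _ ▸ h1 B hB, fun h => h2 (hs F.rhs _ _ ▸ h)⟩
  · rintro ⟨t, hr⟩ ⟨h1, h2⟩
    rw [removeSelfConflicts, Finset.mem_filter] at hr
    exact h2 (hr.2 t (by simp) t (by simp) h1)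
  · let t : Fin 4 → S.Tuple := fun i => (f i).val
    have adj : ∀ i j, Counterexample F (t i) (t j) ↔ (SimpleGraph.pathGraph 4).Adj i j :=
      fun i j => f.map_adj_iff
    have e01 := (adj 0 1).2 (by simp [SimpleGraph.pathGraph_adj])
    have e12 := (adj 1 2).2 (by simp [SimpleGraph.pathGraph_adj])
    have e23 := (adj 2 3).2 (by simp [SimpleGraph.pathGraph_adj])
    have n02 := mt (adj 0 2).1 (by simp [SimpleGraph.pathGraph_adj])
    have n13 := mt (adj 1 3).1 (by simp [SimpleGraph.pathGraph_adj])
    have n03 := mt (adj 0 3).1 (by simp [SimpleGraph.pathGraph_adj])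
    have l02 := fun B hB => ht B _ _ _ (e01.1 B hB) (e12.1 B hB)
    have l13 := fun B hB => ht B _ _ _ (e12.1 B hB) (e23.1 B hB)
    have l03 := fun B hB => ht B _ _ _ (l02 B hB) (e23.1 B hB)
    have r02 := not_not.1 fun h => n02 ⟨l02, h⟩
    have r13 := not_not.1 fun h => n13 ⟨l13, h⟩
    have r03 := not_not.1 fun h => n03 ⟨l03, h⟩
    exact e12.2 (ht _ _ _ _ (ht _ _ _ _ r13 (hs F.rhs _ _ ▸ r03)) r02)

end PredScheme

/-! ### Computation of the largest size of a satisfying subrelation -/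

namespace FDInstance

/-- The rows in the form in which they are part of the input. -/
def codedRows (I : FDInstance.{u}) : List Data := I.rows.map codeTuple

theorem length_codedRows (I : FDInstance.{u}) : I.codedRows.length = I.rows.length :=
  List.length_map _

theorem head_drop_codedRows (I : FDInstance.{u}) (k : Fin I.codedRows.length) :
    (Data.ofList (I.codedRows.drop k)).head =
      codeTuple I.rows[Fin.cast I.length_codedRows k] := by
  rw [Data.head_ofList_drop _ _ k.2]
  simp only [codedRows, List.getElem_map]
  rfl

section

variable {κ : Type v} {K : Family κ} {e : κ → Data} {I : κ → FDInstance.{u}}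
  {i j : (k : κ) → Fin (I k).rows.length}

theorem computes_lhsRel_rhsRel (hbox : ∀ k q O, K.box k q O → (I k).S.EvaluatedBy q O)
    (hI : K.Computes e fun k => (I k).input) (hi : K.Computes e fun k => codeTuple (I k).rows[i k])
    (hj : K.Computes e fun k => codeTuple (I k).rows[j k]) :
    K.Computes e (fun k => .ofBool ((I k).lhsRel (i k) (j k))) ∧
      K.Computes e (fun k => .ofBool ((I k).rhsRel (i k) (j k))) := by
  let p : κ → TuplePair.{u} := fun k => ⟨(I k).S, (I k).F, (I k).rows[i k], (I k).rows[j k]⟩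
  have hp : K.Computes e fun k => (p k).code := hI.head.cons (hi.cons hj)
  exact ⟨hp.comp (TuplePair.computes_lhsAgree.pull p hp.bounded_out hbox),
    hp.comp (TuplePair.computes_rhsAgree.pull p hp.bounded_out hbox)⟩

theorem computes_weight (hbox : ∀ k q O, K.box k q O → (I k).S.EvaluatedBy q O)
    (hI : K.Computes e fun k => (I k).input)
    (hi : K.Computes e fun k => codeTuple (I k).rows[i k]) :
    K.Computes e fun k => .ofNat ((I k).weight (i k)) := by
  have hb := hi.bounded_in
  have hsum := Family.Computes.sum (C := K) (l := fun k => (I k).codedRows) hI.tail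
    (f := fun k => if ((I k.1).lhsRel (i k.1) (Fin.cast (I k.1).length_codedRows k.2) &&
      (I k.1).rhsRel (i k.1) (Fin.cast (I k.1).length_codedRows k.2)) = true then 1 else 0)
    fun e h hrest => by
      have hr := computes_lhsRel_rhsRel (fun k q O => hbox k.1 q O) (h.comp (hI.lift Sigma.fst))
        (h.comp (hi.lift Sigma.fst))
        (hrest.head.congr fun k => (I k.1).head_drop_codedRows k.2)
      exact ((hr.1.and hr.2).ite (fun k => Data.ofBool_ne_nil) (.one h.bounded_in)
        (.zero h.bounded_in)).congr fun k => by split <;> rfl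
  refine ((computes_lhsRel_rhsRel hbox hI hi hi).1.ite (fun k => Data.ofBool_ne_nil) hsum
    (.one hb)).congr
    fun k => ?_
  rw [weight, ← apply_ite]
  congr 2
  exact Fintype.sum_equiv (finCongr (I k).length_codedRows) _ _ fun _ => rfl

theorem computes_maxSat (hs : ∀ k, (I k).S.Symmetric) (ht : ∀ k, (I k).S.Transitive)
    (hbox : ∀ k q O, K.box k q O → (I k).S.EvaluatedBy q O)
    (hI : K.Computes e fun k => (I k).input) :
    K.Computes e fun k => .ofNat (maxSat (I k).F (I k).rel) := by
  let row : (k : Σ k, Fin (I k).codedRows.length) → Fin (I k.1).rows.length :=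
    fun k => Fin.cast (I k.1).length_codedRows k.2
  have hsum := Family.Computes.sum (C := K) (l := fun k => (I k).codedRows) hI.tail
    (f := fun k => (I k.1).weight (row k) - Finset.univ.sup fun j : Fin (I k.1).codedRows.length =>
      if row k < row ⟨k.1, j⟩ ∧ (I k.1).lhsRel (row k) (row ⟨k.1, j⟩) = true then
        (I k.1).weight (row ⟨k.1, j⟩) else 0) fun e h hrest => by
    have hI' := h.comp (hI.lift Sigma.fst)
    have hrow := hrest.head.congr fun k => (I k.1).head_drop_codedRows k.2
    refine (computes_weight (fun k q O => hbox k.1 q O) hI' hrow).sub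
      (Family.Computes.sup (l := fun k => (I k.1).codedRows) hI'.tail
      (f := fun j => if row j.1 < row ⟨j.1.1, j.2⟩ ∧
        (I j.1.1).lhsRel (row j.1) (row ⟨j.1.1, j.2⟩) = true then
        (I j.1.1).weight (row ⟨j.1.1, j.2⟩) else 0) fun e h hrest' => ?_)
    have hrow' := hrest'.head.congr fun j => (I j.1.1).head_drop_codedRows j.2
    have hI'' := h.comp (hI'.lift Sigma.fst)
    have hr := computes_lhsRel_rhsRel (fun k q O => hbox k.1.1 q O) hI''
      (h.comp (hrow.lift Sigma.fst)) hrow'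
    -- the later row is the one with fewer rows from it on
    have hlt := hrest'.length.lt (h.comp (hrest.length.lift Sigma.fst))
    refine ((hlt.and hr.1).ite (fun j => Data.ofBool_ne_nil)
      (computes_weight (fun k q O => hbox k.1.1 q O) hI'' hrow') (.zero h.bounded_in)).congr
      fun j => ?_
    rw [apply_ite Data.ofNat]
    congr 1
    rw [Bool.and_eq_true, decide_eq_true_eq, List.length_drop, List.length_drop, Fin.lt_def]
    have := j.2.2
    have := j.1.2.2
    exact propext (and_congr_left' (by simp only [row, Fin.val_cast]; omega))
  refine hsum.congr fun k => ?_
  rw [maxSat_eq_sum (hs k) (ht k)]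
  congr 1
  have hlen := (I k).length_codedRows
  refine Fintype.sum_equiv (finCongr hlen) _ _ fun x => ?_
  refine congrArg₂ _ rfl ?_
  rw [← Finset.univ_map_equiv_to_embedding (finCongr hlen), Finset.sup_map]
  rfl

end

end FDInstance

/-! ### Comparison with a threshold in binary -/

theorem sum_getD_mul_two_pow (l : List Bool) {L : ℕ} (hL : l.length ≤ L) :
    ∑ j ∈ Finset.range L, (l.getD j false).toNat * 2 ^ j =
      l.foldr (fun b x => b.toNat + 2 * x) 0 := by
  induction l generalizing L with
  | nil => simp
  | cons b l ih =>
    cases L with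
    | zero => simp at hL
    | succ L =>
      rw [Finset.sum_range_succ', List.foldr_cons, ← ih (by simpa using hL), Finset.mul_sum,
        add_comm]
      simp only [List.getD_cons_zero, List.getD_cons_succ, pow_zero, mul_one, pow_succ]
      congr 1
      exact Finset.sum_congr rfl fun j _ => by ring

theorem foldr_encodePosNum (n : PosNum) :
    (Computability.encodePosNum n).foldr (fun b x => b.toNat + 2 * x) 0 = (n : ℕ) := by
  induction n with
  | one => rfl
  | bit1 n ih =>
    rw [Computability.encodePosNum, List.foldr_cons, ih, PosNum.cast_bit1, Bool.toNat_true]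
    ring
  | bit0 n ih =>
    rw [Computability.encodePosNum, List.foldr_cons, ih, PosNum.cast_bit0, Bool.toNat_false]
    ring

/-- Binary numerals have the lowest digit first. -/
theorem sum_encodeNat (x : ℕ) {L : ℕ} (hL : (Computability.encodeNat x).length ≤ L) :
    ∑ j ∈ Finset.range L, ((Computability.encodeNat x).getD j false).toNat * 2 ^ j = x := by
  rw [sum_getD_mul_two_pow _ hL, Computability.encodeNat]
  conv_rhs => rw [← Num.to_of_nat x]
  cases (x : Num) with
  | zero => rfl
  | pos p => exact foldr_encodePosNum p

/-- The carry into place `k` when the numbers `n * e j - (n - M) * d j`, for places `j = 0, 1, …`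
with values `2 ^ j`, are added up, the lowest place first. The carry lies between `-n` and `n` and
is shifted by `n` so as to be a natural number. -/
def shiftedCarry (n M : ℕ) (e d : ℕ → Bool) : ℕ → ℕ
  | 0 => n
  | k + 1 => (shiftedCarry n M e d k + (if e k = true then n else 0) +
      (if d k = true then M else n)) / 2

theorem shiftedCarry_le {n M : ℕ} (h : M ≤ n) (e d : ℕ → Bool) (k : ℕ) :
    shiftedCarry n M e d k ≤ 2 * n := by
  induction k with
  | zero => simp only [shiftedCarry]; omega
  | succ k ih => simp only [shiftedCarry]; split_ifs <;> omega

/-- The unshifted carry is the sum over the places below `k`, divided by `2 ^ k` and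
rounded down. -/
theorem le_shiftedCarry_iff (n M : ℕ) (e d : ℕ → Bool) (k : ℕ) (w : ℤ) :
    n + w ≤ shiftedCarry n M e d k ↔
      2 ^ k * w + (n - M) * ∑ j ∈ Finset.range k, ((d j).toNat : ℤ) * 2 ^ j ≤
        n * ∑ j ∈ Finset.range k, ((e j).toNat : ℤ) * 2 ^ j := by
  induction k generalizing w with
  | zero => simp [shiftedCarry]
  | succ k ih =>
    have h : n + w ≤ shiftedCarry n M e d (k + 1) ↔
        n + (2 * w - n * (e k).toNat + (n - M) * (d k).toNat) ≤ shiftedCarry n M e d k := by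
      simp only [shiftedCarry]
      cases e k <;> cases d k <;> simp <;> omega
    rw [h, ih, Finset.sum_range_succ, Finset.sum_range_succ, pow_succ, ← sub_nonneg,
      ← sub_nonneg (a := (n : ℤ) * _)]
    exact iff_of_eq (congrArg _ (by ring))

/-- The sign of the last carry is that of the whole sum, which compares two products. -/
theorem le_shiftedCarry_encodeNat_iff {n M x y L : ℕ} (hM : M ≤ n)
    (hx : (Computability.encodeNat x).length ≤ L) (hy : (Computability.encodeNat y).length ≤ L) :
    n ≤ shiftedCarry n M (fun j => (Computability.encodeNat x).getD j false)
      (fun j => (Computability.encodeNat y).getD j false) L ↔ (n - M) * y ≤ n * x := by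
  have h := le_shiftedCarry_iff n M (fun j => (Computability.encodeNat x).getD j false)
    (fun j => (Computability.encodeNat y).getD j false) L 0
  have h1 := congrArg (Nat.cast (R := ℤ)) (sum_encodeNat x hx)
  have h2 := congrArg (Nat.cast (R := ℤ)) (sum_encodeNat y hy)
  push_cast at h1 h2
  rw [h1, h2, add_zero, Nat.cast_le, mul_zero, zero_add] at h
  rw [h]
  zify [hM]

theorem Data.head_ofBits_drop (l : List Bool) (k : ℕ) :
    (Data.ofList ((l.map Data.ofBool).drop k)).head = .ofBool (l.getD k false) := by
  induction l generalizing k with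
  | nil => simp [Data.ofList, Data.head, Data.ofBool]
  | cons b l ih =>
    cases k with
    | zero => rfl
    | succ k => simpa using ih k

namespace FDInstance

theorem maxSat_le (I : FDInstance.{u}) : maxSat I.F I.rel ≤ I.rows.length := by
  classical
  refine Finset.sup_le fun s hs => ?_
  simp only [Finset.mem_filter, Finset.mem_powerset] at hs
  exact Finset.card_le_card hs.1

theorem g3_le_iff (I : FDInstance.{u}) (k : ℚ) : g3 I.F I.rel ≤ (k : ℝ) ↔ ¬ k < 0 ∧
    (I.rows.length - maxSat I.F I.rel) * k.den ≤ I.rows.length * k.num.natAbs := by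
  have hM := I.maxSat_le
  have hn : (0 : ℝ) < I.rows.length := by
    exact_mod_cast List.length_pos_iff.2 I.ne_nil
  have hc : I.rel.card = I.rows.length := rfl
  rw [g3, hc]
  generalize maxSat I.F I.rel = M at *
  generalize I.rows.length = n at *
  have hM' : (M : ℝ) ≤ n := by exact_mod_cast hM
  by_cases hk : k < 0
  · simp only [hk, not_true, false_and, iff_false, not_le]
    have h1 : (k : ℝ) < 0 := by exact_mod_cast hk
    have h2 : (M : ℝ) / n ≤ 1 := (div_le_one hn).2 hM'
    linarith
  · simp only [hk, not_false_eq_true, true_and]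
    have hd : (0 : ℝ) < k.den := by exact_mod_cast k.pos
    have hnum : ((k.num.natAbs : ℕ) : ℝ) = (k.num : ℝ) := by
      have : ((k.num.natAbs : ℕ) : ℤ) = k.num :=
        Int.natAbs_of_nonneg (Rat.num_nonneg.2 (not_lt.1 hk))
      rw [← Int.cast_natCast, this]
    have hk' : (k : ℝ) = k.num / k.den := Rat.cast_def k
    rw [hk', ← Nat.cast_le (α := ℝ)]
    push_cast [Nat.cast_sub hM]
    rw [hnum, one_sub_div hn.ne', div_le_div_iff₀ hn hd, mul_comm (n : ℝ)]

section

variable {κ : Type v} {K : Family κ} {e : κ → Data} {I : κ → FDInstance.{u}}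

theorem computes_threshold (hs : ∀ k, (I k).S.Symmetric) (ht : ∀ k, (I k).S.Transitive)
    (hbox : ∀ k q O, K.box k q O → (I k).S.EvaluatedBy q O) {r : κ → ℚ}
    (hI : K.Computes e fun k => (I k).input) (hr : K.Computes e fun k => .ofRat (r k)) :
    K.Computes e fun k => .ofBool (decide (g3 (I k).F (I k).rel ≤ (r k : ℝ))) := by
  have hb := hI.bounded_in
  have hM := computes_maxSat hs ht hbox hI
  have hn : K.Computes e fun k => .ofNat (I k).rows.length :=
    (Family.Computes.length (l := fun k => (I k).codedRows) hI.tail).congr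
      fun k => by rw [length_codedRows]
  let x : κ → List Bool := fun k => Computability.encodeNat (r k).num.natAbs
  let y : κ → List Bool := fun k => Computability.encodeNat (r k).den
  have hx : K.Computes e fun k => .ofList ((x k).map Data.ofBool) := hr.tail.head
  have hy : K.Computes e fun k => .ofList ((y k).map Data.ofBool) := hr.tail.tail
  have hlen : K.Computes e fun k =>
      .ofList (List.replicate ((x k).length + (y k).length) Data.nil) :=
    (hx.length.add hy.length).congr fun k => by simp [Data.ofNat]
  let carry : κ → ℕ → ℕ := fun k => shiftedCarry (I k).rows.length (maxSat (I k).F (I k).rel)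
    (fun j => (x k).getD j false) (fun j => (y k).getD j false)
  have hloop := Family.Computes.loop_body (acc := fun k j => .cons
    (.ofList (((x k).map Data.ofBool).drop j)) (.cons (.ofList (((y k).map Data.ofBool).drop j))
    (.ofNat (carry k j)))) hlen (hx.cons (hy.cons hn)) ?_ fun e h _ hacc => ?_
  · have hlt := hloop.tail.tail.lt hn
    have hneg : K.Computes e fun k => .ofBool (decide (r k < 0)) := hr.head
    refine (hneg.ite (fun k => Data.ofBool_ne_nil) (.nil hb)
      (hlt.ite (fun k => Data.ofBool_ne_nil) (.nil hb) (.isTrue hb))).congr fun k => ?_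
    simp only [carry, List.length_replicate, decide_eq_true_eq, x, y]
    have h1 := le_shiftedCarry_encodeNat_iff (I k).maxSat_le
      (x := (r k).num.natAbs) (y := (r k).den) (Nat.le_add_right _ _) (Nat.le_add_left _ _)
    have h2 := (I k).g3_le_iff (r k)
    rw [← h1, ← not_lt (b := (I k).rows.length)] at h2
    by_cases h3 : r k < 0
    · rw [decide_eq_false fun h => (h2.1 h).1 h3, if_pos h3]
      rfl
    · rw [if_neg h3]
      split_ifs with h4
      · rw [decide_eq_false fun h => (h2.1 h).2 h4]
        rfl
      · rw [decide_eq_true (h2.2 ⟨h3, h4⟩)]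
  · refine .data_cons (((hx.bounded_out).pull _).mono fun k => Data.size_drop_le _ _)
      (.data_cons (((hy.bounded_out).pull _).mono fun k => Data.size_drop_le _ _)
      (Family.bounded_ofNat.2 ?_))
    exact (((Family.Bounded.const 2).mul (Family.bounded_ofNat.1 hn.bounded_out)).pull _).mono
      fun k => shiftedCarry_le (I k.1).maxSat_le _ _ _
  · have hn' := h.comp (hn.lift Sigma.fst)
    have hM' := h.comp (hM.lift Sigma.fst)
    have hdx := hacc.head.head.congr fun k => Data.head_ofBits_drop (x k.1) k.2
    have hdy := hacc.tail.head.head.congr fun k => Data.head_ofBits_drop (y k.1) k.2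
    have h1 := (hdx.ite (fun k => Data.ofBool_ne_nil) hn' (.zero h.bounded_in)).congr
      fun k => (apply_ite Data.ofNat _ _ _).symm
    have h2 := (hdy.ite (fun k => Data.ofBool_ne_nil) hM' hn').congr
      fun k => (apply_ite Data.ofNat _ _ _).symm
    refine (hacc.head.tail.cons (hacc.tail.head.tail.cons
      ((hacc.tail.tail.add h1).add h2).half)).congr fun k => ?_
    exact congrArg₂ _ (Data.tail_ofList_drop _ _) (congrArg₂ _ (Data.tail_ofList_drop _ _) rfl)

end

end FDInstance

open PredScheme in
theorem theorem1 :
    -- the decision problem: is `g₃(r, X → A) ≤ k`, for a rational threshold `k` in the input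
    SolvableInPolyTime
      (fun i : SymTransInstance.{u} × ℚ => Data.cons i.1.val.input (Data.ofRat i.2))
      (fun i => Data.ofBool (decide (g3 i.1.val.F i.1.val.rel ≤ (i.2 : ℝ))))
      (fun i q O => i.1.val.S.EvaluatedBy q O) ∧
    -- the computation of the numerator of `1 - g₃(r, X → A)`, as a fraction over `|r|`
    SolvableInPolyTime
      (fun I : SymTransInstance.{u} => I.val.input)
      (fun I => Data.ofNat (maxSat I.val.F I.val.rel))
      (fun I q O => I.val.S.EvaluatedBy q O) ∧
    -- without self-conflicting tuples, the conflict graph is a loopless undirected cograph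
    (∀ (S : PredScheme.{u}), S.Symmetric → S.Transitive →
      ∀ (F : FuncDep S) (r : Finset S.Tuple),
        ∃ G : SimpleGraph {t // t ∈ removeSelfConflicts F r},
          (∀ t t', G.Adj t t' ↔ Counterexample F t.val t'.val) ∧ IsCograph G) := by
  refine ⟨Family.Computes.solvableInPolyTime ?_, Family.Computes.solvableInPolyTime ?_,
    fun S => exists_isCograph⟩
  · have h := Family.Computes.id (C := ⟨fun i : SymTransInstance.{u} × ℚ =>
      (Data.cons i.1.val.input (Data.ofRat i.2)).size,
      fun i q O => i.1.val.S.EvaluatedBy q O⟩) .self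
    exact FDInstance.computes_threshold (I := fun i : SymTransInstance.{u} × ℚ => i.1.val)
      (fun i => i.1.2.1) (fun i => i.1.2.2) (fun i q O h => h) h.head h.tail
  · have h := Family.Computes.id (C := ⟨fun i : SymTransInstance.{u} => i.val.input.size,
      fun i q O => i.val.S.EvaluatedBy q O⟩) .self
    exact FDInstance.computes_maxSat (I := fun i : SymTransInstance.{u} => i.val)
      (fun i => i.2.1) (fun i => i.2.2) (fun i q O h => h) h
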